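/- Let $\mathcal H=\mathcal H_1\otimes\cdots\otimes\mathcal H_K$ be a multipartite quantum system with finite-dimensional complex Hilbert spaces $\mathcal H_i$. Let $|\phi_1\rangle,\dots,|\phi_n\rangle\in\mathcal H$ ($n\ge 1$) be pure product states (unit vectors of the form $a_1\otimes\cdots\otimes a_K$) that are perfectly distinguishable by LOCC, i.e. some measurement $\{M_1,\dots,M_n\}$ realizable by finitely many rounds of local measurements and classical communication satisfies $\langle\phi_j|M_k|\phi_j\rangle=\delta_{kj}$ for all $k,j$ (in particular, they are pairwise orthogonal). Let $\sigma$ be any state (density operator, pure or mixed) on $\mathcal H$ whose support is contained in the orthogonal complement of $\{|\phi_1\rangle,\dots,|\phi_n\rangle\}$. Then the $n+1$ states $\rho_j=|\phi_j\rangle\langle\phi_j|$ ($1\le j\le n$) and $\rho_{n+1}=\sigma$ are perfectly distinguishable by separable operations: there is a separable POVM $\{\Pi_1,\dots,\Pi_{n+1}\}$ on $\mathcal H$ such that $\operatorname{tr}(\Pi_k\rho_j)=\delta_{kj}$ for all $1\le k,j\le n+1$. Here a POVM is a family of positive semidefinite operators with $\sum_k\Pi_k=I_{\mathcal H}$; it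 is separable if every $\Pi_k$ is nonzero and $\Pi_k/\operatorname{tr}(\Pi_k)$ is a convex combination of projectors $|\psi\rangle\langle\psi|$ onto pure product states. -/

import Mathlib

open scoped ComplexOrder Matrix

/-- The computational basis of `ℂ^{d 0} ⊗ ⋯ ⊗ ℂ^{d (K-1)}`: vectors of this multipartite space are
functions `MIdx d → ℂ`, operators on it are matrices indexed by `MIdx d`. -/
abbrev MIdx {K : ℕ} (d : Fin K → ℕ) : Type := ∀ i, Fin (d i)

/-- The tensor product `⊗ i, a i` of local vectors. -/
def tensorVec {K : ℕ} {d : Fin K → ℕ} (a : ∀ i, Fin (d i) → ℂ) : MIdx d → ℂ :=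
  fun x => ∏ i, a i (x i)

/-- The tensor product `⊗ i, B i` of local operators `B i : ℂ^{d i} → ℂ^{d' i}`. -/
def tensorOp {K : ℕ} {d d' : Fin K → ℕ} (B : ∀ i, Matrix (Fin (d' i)) (Fin (d i)) ℂ) :
    Matrix (MIdx d') (MIdx d) ℂ :=
  Matrix.of fun x y => ∏ i, B i (x i) (y i)

/-- The operator `|ψ⟩⟨ψ|`. -/
def ketbra {n : Type*} (ψ : n → ℂ) : Matrix n n ℂ := Matrix.vecMulVec ψ (star ψ)

/-- Density operators: positive semidefinite of trace one. -/
def IsDensity {n : Type*} [Fintype n] (ρ : Matrix n n ℂ) : Prop :=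
  ρ.PosSemidef ∧ ρ.trace = 1

/-- The support of a density operator. For a positive semidefinite operator the span of the
eigenvectors with positive eigenvalue is its range. -/
def stateSupport {n : Type*} [Fintype n] (ρ : Matrix n n ℂ) : Submodule ℂ (n → ℂ) :=
  LinearMap.range ρ.mulVecLin

/-- Pure product states: unit vectors of the form `⊗ i, a i`. -/
def IsProductState {K : ℕ} {d : Fin K → ℕ} (ψ : MIdx d → ℂ) : Prop :=
  star ψ ⬝ᵥ ψ = 1 ∧ ∃ a : ∀ i, Fin (d i) → ℂ, ψ = tensorVec a

/-- Separable states: finite convex combinations of pure product states. -/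
def IsSeparableState {K : ℕ} {d : Fin K → ℕ} (ρ : Matrix (MIdx d) (MIdx d) ℂ) : Prop :=
  ∃ (m : ℕ) (p : Fin m → ℝ) (ψ : Fin m → MIdx d → ℂ),
    (∀ k, 0 < p k) ∧ ∑ k, p k = 1 ∧ (∀ k, IsProductState (ψ k)) ∧
      ρ = ∑ k, (p k : ℂ) • ketbra (ψ k)

/-- A nonzero positive semidefinite operator is separable if its normalization is. -/
def IsSeparableOp {K : ℕ} {d : Fin K → ℕ} (E : Matrix (MIdx d) (MIdx d) ℂ) : Prop :=
  E ≠ 0 ∧ E.PosSemidef ∧ IsSeparableState (E.trace⁻¹ • E)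

/-- Separable POVMs with outcome set `Ω`. -/
def IsSeparablePOVM {K : ℕ} {d : Fin K → ℕ} {Ω : Type*} [Fintype Ω]
    (P : Ω → Matrix (MIdx d) (MIdx d) ℂ) : Prop :=
  (∀ ω, IsSeparableOp (P ω)) ∧ ∑ ω, P ω = 1

/-- The measurements (given by their POVM) with outcomes in `Ω` that are realized by an LOCC
protocol with finitely many rounds.

* `decide ω`: the parties stop and output `ω`.
* `round`: party `i` measures its system with Kraus operators `B k i`, `k = 0, …, m - 1`, and
  announces the result `k`. The other parties may embed their systems isometrically into larger
  ones (attach ancillas, apply unitaries). The protocol then continues, depending on `k`, with an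
  LOCC protocol on the resulting system, whose local dimensions `d' k j` may have changed.

The POVM of the composite protocol is `N ω = ∑ k, (⊗ j, B k j)ᴴ * M k ω * (⊗ j, B k j)`. Shared
randomness, discarding a subsystem and forgetting part of a result are all included: they are
measurements whose result is not used later. -/
inductive IsLOCC {K : ℕ} {Ω : Type*} [DecidableEq Ω] :
    (d : Fin K → ℕ) → (Ω → Matrix (MIdx d) (MIdx d) ℂ) → Prop
  | decide (d : Fin K → ℕ) (ω : Ω) : IsLOCC d (fun ω' => if ω' = ω then 1 else 0)
  | round (d : Fin K → ℕ) (i : Fin K) (m : ℕ) (d' : Fin m → Fin K → ℕ)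
      (B : ∀ k j, Matrix (Fin (d' k j)) (Fin (d j)) ℂ)
      (hmeas : ∑ k, (B k i)ᴴ * B k i = 1)
      (hisom : ∀ k j, j ≠ i → (B k j)ᴴ * B k j = 1)
      (M : ∀ k, Ω → Matrix (MIdx (d' k)) (MIdx (d' k)) ℂ)
      (hM : ∀ k, IsLOCC (d' k) (M k)) :
      IsLOCC d (fun ω => ∑ k, (tensorOp (B k))ᴴ * M k ω * tensorOp (B k))

/-- The measurement `P` identifies the members of the family `ρ` with certainty. -/
def Discriminates {n Ω : Type*} [Fintype n] [DecidableEq Ω]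
    (P ρ : Ω → Matrix n n ℂ) : Prop :=
  ∀ k j, (P k * ρ j).trace = if k = j then 1 else 0

/-- Perfect distinguishability of a family of states by LOCC. -/
def LOCCDistinguishable {K : ℕ} {d : Fin K → ℕ} {Ω : Type*} [DecidableEq Ω]
    (ρ : Ω → Matrix (MIdx d) (MIdx d) ℂ) : Prop :=
  ∃ P : Ω → Matrix (MIdx d) (MIdx d) ℂ, IsLOCC d P ∧ Discriminates P ρ

/-- Perfect distinguishability of a family of states by separable operations, that is, by a
separable POVM. -/
def SepDistinguishable {K : ℕ} {d : Fin K → ℕ} {Ω : Type*} [Fintype Ω] [DecidableEq Ω]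
    (ρ : Ω → Matrix (MIdx d) (MIdx d) ℂ) : Prop :=
  ∃ P : Ω → Matrix (MIdx d) (MIdx d) ℂ, IsSeparablePOVM P ∧ Discriminates P ρ

/-! The projectors onto the orthonormal φ_j, completed by Q = 1 - ∑ |φ_j⟩⟨φ_j|, discriminate the
states; what has to be shown is that Q is separable. This is
`IsLOCC.one_sub_sum_ketbra_mem_sepCone`, by induction on the protocol. Write P_v for the projector
onto the line of v, with P_0 = 0. When the protocol stops, every vector except the one announced is
zero, and 1 - P_a for a product vector a expands into tensor products of the local P and 1 - P
(`one_sub_ketbra_tensorVec_mem_sepCone`). For a round with operators B_k, 1 - ∑_ω P_{a_ω} = ∑_k B_kᴴ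
(1 - ∑_ω P_{B_k a_ω}) B_k + ∑_ω (∑_k B_kᴴ P_{B_k a_ω} B_k - P_{a_ω}). The first sum is separable by
induction. Each term of the second is a single product operator, since only the measuring party's
factor depends on k; that factor is positive by Cauchy–Schwarz (`posSemidef_sum_ketbra_sub`). -/

/-! ### Algebra of product vectors and product operators -/

section Tensor

variable {K : ℕ} {d d' d'' : Fin K → ℕ}

lemma tensorOp_mul (A : ∀ i, Matrix (Fin (d'' i)) (Fin (d' i)) ℂ)
    (B : ∀ i, Matrix (Fin (d' i)) (Fin (d i)) ℂ) :
    tensorOp A * tensorOp B = tensorOp (fun i => A i * B i) := by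
  ext x y
  simp only [tensorOp, Matrix.mul_apply, Matrix.of_apply, ← Finset.prod_mul_distrib]
  rw [Finset.prod_univ_sum, Fintype.piFinset_univ]

lemma tensorOp_conjTranspose (B : ∀ i, Matrix (Fin (d' i)) (Fin (d i)) ℂ) :
    (tensorOp B)ᴴ = tensorOp (fun i => (B i)ᴴ) := by
  ext x y
  simp [tensorOp, Matrix.conjTranspose_apply]

lemma tensorOp_mulVec (B : ∀ i, Matrix (Fin (d' i)) (Fin (d i)) ℂ) (a : ∀ i, Fin (d i) → ℂ) :
    tensorOp B *ᵥ tensorVec a = tensorVec (fun i => B i *ᵥ a i) := by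
  ext x
  simp only [tensorOp, tensorVec, Matrix.mulVec, dotProduct, Matrix.of_apply,
    ← Finset.prod_mul_distrib]
  rw [Finset.prod_univ_sum, Fintype.piFinset_univ]

lemma star_tensorVec_dotProduct (a b : ∀ i, Fin (d i) → ℂ) :
    star (tensorVec a) ⬝ᵥ tensorVec b = ∏ i, star (a i) ⬝ᵥ b i := by
  simp only [tensorVec, dotProduct, Pi.star_apply, star_prod, ← Finset.prod_mul_distrib]
  rw [Finset.prod_univ_sum, Fintype.piFinset_univ]

lemma tensorOp_one : tensorOp (fun i => (1 : Matrix (Fin (d i)) (Fin (d i)) ℂ)) = 1 := by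
  ext x y
  by_cases h : x = y
  · subst h
    simp only [tensorOp, Matrix.of_apply, Matrix.one_apply_eq, Finset.prod_const_one]
  · obtain ⟨i, hi⟩ := Function.ne_iff.1 h
    simp only [tensorOp, Matrix.of_apply, Matrix.one_apply_ne h]
    exact Finset.prod_eq_zero (Finset.mem_univ i) (Matrix.one_apply_ne hi)

lemma tensorOp_sum {κ : Fin K → Type*} [∀ i, Fintype (κ i)]
    (A : ∀ i, κ i → Matrix (Fin (d' i)) (Fin (d i)) ℂ) :
    tensorOp (fun i => ∑ k, A i k) = ∑ f : ∀ i, κ i, tensorOp (fun i => A i (f i)) := by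
  classical
  ext x y
  simp only [tensorOp, Matrix.of_apply, Matrix.sum_apply]
  rw [Finset.prod_univ_sum, Fintype.piFinset_univ]

lemma tensorOp_smul (c : Fin K → ℂ) (A : ∀ i, Matrix (Fin (d' i)) (Fin (d i)) ℂ) :
    tensorOp (fun i => c i • A i) = (∏ i, c i) • tensorOp A := by
  ext x y
  simp [tensorOp, Finset.prod_mul_distrib]

lemma ketbra_tensorVec (a : ∀ i, Fin (d i) → ℂ) :
    ketbra (tensorVec a) = tensorOp (fun i => ketbra (a i)) := by
  ext x y
  simp [tensorOp, ketbra, tensorVec, Matrix.vecMulVec_apply, Finset.prod_mul_distrib]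

/-- The tensor product of local operators as a linear function of the `i`-th factor. -/
def tensorOpSlot (A : ∀ i, Matrix (Fin (d' i)) (Fin (d i)) ℂ) (i : Fin K) :
    Matrix (Fin (d' i)) (Fin (d i)) ℂ →ₗ[ℂ] Matrix (MIdx d') (MIdx d) ℂ where
  toFun X := tensorOp (Function.update A i X)
  map_add' X Y := by
    ext x y
    simp only [tensorOp, Matrix.of_apply, Matrix.add_apply]
    simp only [← Finset.mul_prod_erase _ _ (Finset.mem_univ i), Function.update_self,
      Matrix.add_apply, add_mul]
    congr 2 <;> refine Finset.prod_congr rfl fun j hj => ?_ <;>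
      simp [Function.update_of_ne (Finset.ne_of_mem_erase hj)]
  map_smul' c X := by
    ext x y
    simp only [tensorOp, Matrix.of_apply, Matrix.smul_apply, RingHom.id_apply]
    simp only [← Finset.mul_prod_erase _ _ (Finset.mem_univ i), Function.update_self,
      Matrix.smul_apply, smul_eq_mul, mul_assoc]
    congr 2
    refine Finset.prod_congr rfl fun j hj => ?_
    simp [Function.update_of_ne (Finset.ne_of_mem_erase hj)]

lemma tensorOpSlot_apply (A : ∀ i, Matrix (Fin (d' i)) (Fin (d i)) ℂ) (i : Fin K)
    (X : Matrix (Fin (d' i)) (Fin (d i)) ℂ) :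
    tensorOpSlot A i X = tensorOp (Function.update A i X) := rfl

lemma tensorOp_eq_tensorOpSlot (A C : ∀ i, Matrix (Fin (d' i)) (Fin (d i)) ℂ) (i : Fin K)
    (h : ∀ j, j ≠ i → C j = A j) : tensorOp C = tensorOpSlot A i (C i) := by
  rw [tensorOpSlot_apply]
  congr 1
  rw [Function.eq_update_iff]
  exact ⟨rfl, h⟩

end Tensor

/-! ### Rank-one operators and the local positivity inequality -/

section Ketbra

variable {m n : Type*} [Fintype n]

lemma star_dotProduct_self_re_nonneg (v : n → ℂ) : 0 ≤ (star v ⬝ᵥ v).re :=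
  (Complex.nonneg_iff.1 (dotProduct_star_self_nonneg v)).1

lemma star_dotProduct_self_eq_ofReal (v : n → ℂ) : star v ⬝ᵥ v = ((star v ⬝ᵥ v).re : ℂ) :=
  Complex.ext rfl (Complex.nonneg_iff.1 (dotProduct_star_self_nonneg v)).2.symm

lemma ketbra_smul (c : ℂ) (v : n → ℂ) : ketbra (c • v) = (c * star c) • ketbra v := by
  ext x y
  simp [ketbra, Matrix.vecMulVec_apply]
  ring

lemma mul_ketbra_mul_conjTranspose (A : Matrix m n ℂ) (v : n → ℂ) :
    A * ketbra v * Aᴴ = ketbra (A *ᵥ v) := by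
  rw [ketbra, ketbra, Matrix.mul_vecMulVec, Matrix.vecMulVec_mul, Matrix.star_mulVec]

lemma posSemidef_ketbra (v : n → ℂ) : (ketbra v).PosSemidef :=
  Matrix.posSemidef_vecMulVec_self_star v

lemma trace_ketbra_mul (v : n → ℂ) (A : Matrix n n ℂ) :
    (ketbra v * A).trace = star v ⬝ᵥ (A *ᵥ v) := by
  rw [Matrix.trace_mul_comm, ketbra, Matrix.mul_vecMulVec, Matrix.trace_vecMulVec, dotProduct_comm]

lemma ketbra_mulVec (v x : n → ℂ) : ketbra v *ᵥ x = (star v ⬝ᵥ x) • v := by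
  ext y
  simp [ketbra, Matrix.vecMulVec_mulVec, mul_comm]

lemma dotProduct_ketbra_mulVec (v x : n → ℂ) :
    star x ⬝ᵥ (ketbra v *ᵥ x) = ((‖star x ⬝ᵥ v‖ ^ 2 : ℝ) : ℂ) := by
  rw [ketbra_mulVec, dotProduct_smul, smul_eq_mul, mul_comm]
  rw [Matrix.star_dotProduct v x]
  push_cast
  exact Complex.mul_conj' _

/-- The subtracted operator is a self-adjoint idempotent, so its complement R equals Rᴴ R. For v = 0
the convention 0⁻¹ = 0 makes it zero. -/
lemma posSemidef_one_sub_ketbra [DecidableEq n] (v : n → ℂ) :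
    (1 - (star v ⬝ᵥ v)⁻¹ • ketbra v).PosSemidef := by
  set P := (star v ⬝ᵥ v)⁻¹ • ketbra v with hP
  have hH : Pᴴ = P := by
    rw [hP, Matrix.conjTranspose_smul, (posSemidef_ketbra v).isHermitian.eq, star_inv₀,
      ← Matrix.star_dotProduct]
  have hI : P * P = P := by
    by_cases h : star v ⬝ᵥ v = 0
    · simp [hP, h]
    · rw [hP, Matrix.smul_mul, Matrix.mul_smul, ketbra, Matrix.vecMulVec_mul_vecMulVec,
        Matrix.vecMulVec_smul, smul_smul (_⁻¹) (star v ⬝ᵥ v), inv_mul_cancel₀ h, one_smul]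
  have : 1 - P = (1 - P)ᴴ * (1 - P) := by
    rw [Matrix.conjTranspose_sub, Matrix.conjTranspose_one, hH]
    rw [Matrix.sub_mul, Matrix.mul_sub P, Matrix.one_mul, Matrix.mul_one, hI, sub_self, sub_zero]
  rw [this]
  exact Matrix.posSemidef_conjTranspose_mul_self _

/-- Cauchy–Schwarz with weights that may vanish; `hz` makes the convention 0⁻¹ = 0 harmless. -/
lemma norm_sq_sum_le {ι : Type*} (s : Finset ι) (z : ι → ℂ) (e : ι → ℝ) (he : ∀ k, 0 ≤ e k)
    (hz : ∀ k, e k = 0 → z k = 0) :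
    (∑ k ∈ s, e k)⁻¹ * ‖∑ k ∈ s, z k‖ ^ 2 ≤ ∑ k ∈ s, (e k)⁻¹ * ‖z k‖ ^ 2 := by
  have hf : ∀ k, 0 ≤ (e k)⁻¹ * ‖z k‖ ^ 2 := fun k => mul_nonneg (inv_nonneg.2 (he k)) (sq_nonneg _)
  have h1 : (∑ k ∈ s, ‖z k‖) ^ 2 ≤ (∑ k ∈ s, (e k)⁻¹ * ‖z k‖ ^ 2) * ∑ k ∈ s, e k := by
    refine Finset.sum_sq_le_sum_mul_sum_of_sq_le_mul s (fun k _ => hf k) (fun k _ => he k) ?_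
    intro k _
    by_cases h : e k = 0
    · simp [h, hz k h]
    · exact le_of_eq (by field_simp)
  have h2 : ‖∑ k ∈ s, z k‖ ^ 2 ≤ (∑ k ∈ s, ‖z k‖) ^ 2 := by
    gcongr
    exact norm_sum_le _ _
  rcases (Finset.sum_nonneg fun k (_ : k ∈ s) => he k).eq_or_lt with h | h
  · rw [← h, inv_zero, zero_mul]
    exact Finset.sum_nonneg fun k _ => hf k
  · rw [inv_mul_le_iff₀ h, mul_comm]
    exact h2.trans h1

/-- A measurement `C` does not decrease the normalized projector onto `a`, once the projectors onto
the post-measurement vectors are pulled back. -/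
lemma posSemidef_sum_ketbra_sub {ι : Type*} [Fintype ι] [DecidableEq n] {p : ι → Type*}
    [∀ k, Fintype (p k)] (C : ∀ k, Matrix (p k) n ℂ) (hC : ∑ k, (C k)ᴴ * C k = 1) (a : n → ℂ) :
    (∑ k, (star (C k *ᵥ a) ⬝ᵥ (C k *ᵥ a))⁻¹ • ketbra (((C k)ᴴ * C k) *ᵥ a) -
      (star a ⬝ᵥ a)⁻¹ • ketbra a).PosSemidef := by
  have hsmul : ∀ (c : ℂ) (w : n → ℂ), 0 ≤ c → (c⁻¹ • ketbra w).PosSemidef := fun c w hc =>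
    (posSemidef_ketbra w).smul (inv_nonneg.2 hc)
  refine Matrix.PosSemidef.of_dotProduct_mulVec_nonneg ?_ ?_
  · exact (Matrix.posSemidef_sum _ fun k _ => hsmul _ _
      (dotProduct_star_self_nonneg _)).isHermitian.sub
        (hsmul _ _ (dotProduct_star_self_nonneg _)).isHermitian
  intro x
  -- The weights are the outcome probabilities ‖C k a‖² (up to ‖a‖²). By completeness the vectors (C
  -- k)ᴴ C k a sum to a and the weights sum to ‖a‖².
  set e : ι → ℝ := fun k => (star (C k *ᵥ a) ⬝ᵥ (C k *ᵥ a)).re with he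
  have hsum : ∑ k, ((C k)ᴴ * C k) *ᵥ a = a := by
    rw [← Matrix.sum_mulVec, hC, Matrix.one_mulVec]
  have hee : ∀ k, star (C k *ᵥ a) ⬝ᵥ (C k *ᵥ a) = star a ⬝ᵥ ((C k)ᴴ * C k) *ᵥ a := by
    intro k
    rw [Matrix.star_mulVec, ← Matrix.dotProduct_mulVec, Matrix.mulVec_mulVec]
  have hesum : star a ⬝ᵥ a = ((∑ k, e k : ℝ) : ℂ) := by
    conv_lhs => arg 2; rw [← hsum]
    rw [dotProduct_sum]
    push_cast
    exact Finset.sum_congr rfl fun k _ => by rw [← hee, star_dotProduct_self_eq_ofReal]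
  have hxa : star x ⬝ᵥ a = ∑ k, star x ⬝ᵥ ((C k)ᴴ * C k) *ᵥ a := by
    rw [← dotProduct_sum, hsum]
  have hcs := norm_sq_sum_le Finset.univ (fun k => star x ⬝ᵥ ((C k)ᴴ * C k) *ᵥ a) e
    (fun k => star_dotProduct_self_re_nonneg _) (fun k hk => by
      have h0 : star (C k *ᵥ a) ⬝ᵥ (C k *ᵥ a) = 0 := by
        rw [star_dotProduct_self_eq_ofReal]; exact_mod_cast hk
      rw [dotProduct_star_self_eq_zero] at h0
      simp [← Matrix.mulVec_mulVec, h0])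
  rw [← hxa] at hcs
  have : star x ⬝ᵥ (∑ k, (star (C k *ᵥ a) ⬝ᵥ (C k *ᵥ a))⁻¹ • ketbra (((C k)ᴴ * C k) *ᵥ a) -
      (star a ⬝ᵥ a)⁻¹ • ketbra a) *ᵥ x = ((∑ k, (e k)⁻¹ * ‖star x ⬝ᵥ ((C k)ᴴ * C k) *ᵥ a‖ ^ 2 -
        (∑ k, e k)⁻¹ * ‖star x ⬝ᵥ a‖ ^ 2 : ℝ) : ℂ) := by
    rw [Matrix.sub_mulVec, Matrix.sum_mulVec, dotProduct_sub, dotProduct_sum, Complex.ofReal_sub,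
      Complex.ofReal_sum]
    congr 1
    · refine Finset.sum_congr rfl fun k _ => ?_
      rw [Matrix.smul_mulVec, dotProduct_smul, dotProduct_ketbra_mulVec, smul_eq_mul,
        star_dotProduct_self_eq_ofReal (C k *ᵥ a), Complex.ofReal_mul, Complex.ofReal_inv]
    · rw [Matrix.smul_mulVec, dotProduct_smul, dotProduct_ketbra_mulVec, hesum,
        smul_eq_mul, Complex.ofReal_mul, Complex.ofReal_inv]
  rw [this]
  exact Complex.zero_le_real.2 (sub_nonneg.2 hcs)

end Ketbra

/-! ### The cone of separable operators -/

section SepCone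

variable {K : ℕ} {d d' : Fin K → ℕ}

/-- The cone of unnormalized separable operators. -/
def sepCone (d : Fin K → ℕ) : AddSubmonoid (Matrix (MIdx d) (MIdx d) ℂ) :=
  AddSubmonoid.closure {E | ∃ (r : ℝ) (ψ : MIdx d → ℂ), 0 < r ∧ IsProductState ψ ∧
    E = (r : ℂ) • ketbra ψ}

lemma ofReal_smul_ketbra_tensorVec_mem {r : ℝ} (hr : 0 ≤ r) (a : ∀ i, Fin (d i) → ℂ) :
    (r : ℂ) • ketbra (tensorVec a) ∈ sepCone d := by
  have key : ∀ i, ∃ t : ℝ, ∃ b : Fin (d i) → ℂ, 0 ≤ t ∧ a i = (t : ℂ) • b ∧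
      (t ≠ 0 → star b ⬝ᵥ b = 1) := by
    intro i
    have h := star_dotProduct_self_re_nonneg (a i)
    have hq := star_dotProduct_self_eq_ofReal (a i)
    set q := (star (a i) ⬝ᵥ a i).re
    -- A zero factor gives t = 0 and a b that is not a unit vector; the whole product then vanishes,
    -- so b is irrelevant.
    refine ⟨√q, ((√q)⁻¹ : ℂ) • a i, Real.sqrt_nonneg _, ?_, ?_⟩
    · by_cases h0 : √q = 0
      · rw [Real.sqrt_eq_zero h] at h0
        rw [h0, Complex.ofReal_zero, dotProduct_star_self_eq_zero] at hq
        simp [hq]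
      · rw [smul_smul, mul_inv_cancel₀ (by exact_mod_cast h0), one_smul]
    · intro h0
      rw [star_smul, smul_dotProduct, dotProduct_smul, hq, smul_eq_mul, smul_eq_mul,
        ← Complex.ofReal_inv, ← starRingEnd_apply, Complex.conj_ofReal]
      norm_cast
      rw [← mul_assoc, ← mul_inv, Real.mul_self_sqrt h,
        inv_mul_cancel₀ fun hq0 => h0 (by rw [hq0, Real.sqrt_zero])]
  choose t b ht hab hb using key
  have hv : tensorVec a = ((∏ i, t i : ℝ) : ℂ) • tensorVec b := by
    ext x
    simp [tensorVec, fun i => congrFun (hab i) (x i), Finset.prod_mul_distrib]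
  rw [hv, ketbra_smul, smul_smul, ← starRingEnd_apply, Complex.conj_ofReal]
  norm_cast
  have hs : 0 ≤ r * ((∏ i, t i) * ∏ i, t i) := mul_nonneg hr (mul_self_nonneg _)
  rcases hs.eq_or_lt with h | h
  · rw [← h]
    simp
  · refine AddSubmonoid.subset_closure ⟨_, _, h, ⟨?_, b, rfl⟩, rfl⟩
    rw [star_tensorVec_dotProduct]
    refine Finset.prod_eq_one fun i _ => hb i fun h0 => ?_
    rw [Finset.prod_eq_zero (Finset.mem_univ i) h0] at h
    simp at h

/-- Each factor is a sum of rank-one operators; multilinearity turns the product into a sum of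
product ketbras. -/
lemma tensorOp_mem_sepCone (A : ∀ i, Matrix (Fin (d i)) (Fin (d i)) ℂ)
    (hA : ∀ i, (A i).PosSemidef) : tensorOp A ∈ sepCone d := by
  choose m b hb using fun i => Matrix.posSemidef_iff_eq_sum_vecMulVec.1 (hA i)
  obtain rfl : A = fun i => ∑ k, ketbra (b i k) := funext hb
  rw [tensorOp_sum]
  refine sum_mem fun f _ => ?_
  rw [← ketbra_tensorVec]
  simpa using ofReal_smul_ketbra_tensorVec_mem zero_le_one (fun i => b i (f i))

lemma conj_tensorOp_mem_sepCone (B : ∀ i, Matrix (Fin (d' i)) (Fin (d i)) ℂ)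
    {E : Matrix (MIdx d') (MIdx d') ℂ} (hE : E ∈ sepCone d') :
    (tensorOp B)ᴴ * E * tensorOp B ∈ sepCone d := by
  induction hE using AddSubmonoid.closure_induction with
  | mem E h =>
    obtain ⟨r, ψ, hr, ⟨-, a, rfl⟩, rfl⟩ := h
    have := mul_ketbra_mul_conjTranspose (tensorOp B)ᴴ (tensorVec a)
    rw [Matrix.conjTranspose_conjTranspose] at this
    rw [Matrix.mul_smul, Matrix.smul_mul, this, tensorOp_conjTranspose, tensorOp_mulVec]
    exact ofReal_smul_ketbra_tensorVec_mem hr.le _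
  | zero => simp
  | add E F _ _ hE hF =>
    rw [Matrix.mul_add, Matrix.add_mul]
    exact add_mem hE hF

/-- The trace is the sum of the coefficients, so dividing by it produces convex weights. -/
lemma isSeparableOp_of_mem_sepCone {E : Matrix (MIdx d) (MIdx d) ℂ} (hE : E ∈ sepCone d)
    (h0 : E ≠ 0) : IsSeparableOp E := by
  obtain ⟨l, hl, hsum⟩ := AddSubmonoid.exists_list_of_mem_closure hE
  have : ∀ k : Fin l.length, ∃ (r : ℝ) (ψ : MIdx d → ℂ), 0 < r ∧ IsProductState ψ ∧
    l.get k = (r : ℂ) • ketbra ψ := fun k => hl _ (List.get_mem l k)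
  choose r ψ hr hψ hk using this
  have hEsum : E = ∑ k, (r k : ℂ) • ketbra (ψ k) := by
    rw [← hsum]
    conv_lhs => rw [← List.ofFn_get l, List.sum_ofFn]
    exact Finset.sum_congr rfl fun k _ => hk k
  have htr : E.trace = ((∑ k, r k : ℝ) : ℂ) := by
    rw [hEsum, Matrix.trace_sum]
    push_cast
    refine Finset.sum_congr rfl fun k _ => ?_
    rw [Matrix.trace_smul, ketbra, Matrix.trace_vecMulVec, dotProduct_comm, (hψ k).1, smul_eq_mul,
      mul_one]
  have hne : (Finset.univ : Finset (Fin l.length)).Nonempty := by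
    rw [Finset.nonempty_iff_ne_empty]
    intro h
    rw [h, Finset.sum_empty] at hEsum
    exact h0 hEsum
  have hpos : 0 < ∑ k, r k := Finset.sum_pos (fun k _ => hr k) hne
  refine ⟨h0, ?_, l.length, fun k => (∑ k, r k)⁻¹ * r k, ψ, fun k => by have := hr k; positivity,
    ?_, hψ, ?_⟩
  · rw [hEsum]
    exact Matrix.posSemidef_sum _ fun k _ =>
      (posSemidef_ketbra _).smul (Complex.zero_le_real.2 (hr k).le)
  · rw [← Finset.mul_sum, inv_mul_cancel₀ hpos.ne']
  · rw [htr]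
    conv_lhs => rw [hEsum]
    rw [Finset.smul_sum]
    refine Finset.sum_congr rfl fun k _ => ?_
    rw [smul_smul]
    push_cast
    rfl

/-- Expand 1 = ⊗ (P i + (1 - P i)) over Boolean strings; the subtracted projector is exactly the
all-`true` term. -/
lemma one_sub_ketbra_tensorVec_mem_sepCone (a : ∀ i, Fin (d i) → ℂ) :
    1 - (star (tensorVec a) ⬝ᵥ tensorVec a)⁻¹ • ketbra (tensorVec a) ∈ sepCone d := by
  set P : ∀ i, Matrix (Fin (d i)) (Fin (d i)) ℂ :=
    fun i => (star (a i) ⬝ᵥ a i)⁻¹ • ketbra (a i) with hP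
  have hPpos : ∀ i, (P i).PosSemidef := fun i => (posSemidef_ketbra _).smul
    (inv_nonneg.2 (dotProduct_star_self_nonneg _))
  set A : ∀ i, Bool → Matrix (Fin (d i)) (Fin (d i)) ℂ :=
    fun i b => if b then P i else 1 - P i with hA
  have hApos : ∀ i b, (A i b).PosSemidef := by
    intro i b
    cases b
    · simpa [hA] using posSemidef_one_sub_ketbra (a i)
    · simpa [hA] using hPpos i
  have h1 : (1 : Matrix (MIdx d) (MIdx d) ℂ) =
      ∑ f : Fin K → Bool, tensorOp (fun i => A i (f i)) := by
    rw [← tensorOp_sum, ← tensorOp_one]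
    congr 1
    ext1 i
    simp [hA]
  have h2 : (star (tensorVec a) ⬝ᵥ tensorVec a)⁻¹ • ketbra (tensorVec a) =
      tensorOp (fun i => A i ((fun _ => true : Fin K → Bool) i)) := by
    rw [star_tensorVec_dotProduct, ketbra_tensorVec, ← Finset.prod_inv_distrib, ← tensorOp_smul]
    simp [hA, hP]
  rw [h1, h2, ← Finset.add_sum_erase _ _ (Finset.mem_univ (fun _ => true : Fin K → Bool)),
    add_sub_cancel_left]
  exact sum_mem fun f _ => tensorOp_mem_sepCone _ fun i => hApos i _

/-- A one-party measurement followed by local isometries: the difference between the pulled back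
normalized projectors and the original one is separable. -/
lemma sum_ketbra_sub_mem_sepCone {m : ℕ} {d' : Fin m → Fin K → ℕ} (i : Fin K)
    (B : ∀ k j, Matrix (Fin (d' k j)) (Fin (d j)) ℂ)
    (hmeas : ∑ k, (B k i)ᴴ * B k i = 1)
    (hisom : ∀ k j, j ≠ i → (B k j)ᴴ * B k j = 1) (a : ∀ i, Fin (d i) → ℂ) :
    ∑ k, (star (tensorVec fun j => B k j *ᵥ a j) ⬝ᵥ tensorVec fun j => B k j *ᵥ a j)⁻¹ •
        ketbra (tensorVec fun j => ((B k j)ᴴ * B k j) *ᵥ a j) -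
      (star (tensorVec a) ⬝ᵥ tensorVec a)⁻¹ • ketbra (tensorVec a) ∈ sepCone d := by
  set P : ∀ i, Matrix (Fin (d i)) (Fin (d i)) ℂ :=
    fun i => (star (a i) ⬝ᵥ a i)⁻¹ • ketbra (a i) with hP
  have hPpos : ∀ i, (P i).PosSemidef := fun i => (posSemidef_ketbra _).smul
    (inv_nonneg.2 (dotProduct_star_self_nonneg _))
  have h1 : ∀ k, (star (tensorVec fun j => B k j *ᵥ a j) ⬝ᵥ tensorVec fun j => B k j *ᵥ a j)⁻¹ •
        ketbra (tensorVec fun j => ((B k j)ᴴ * B k j) *ᵥ a j) =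
      tensorOpSlot P i ((star (B k i *ᵥ a i) ⬝ᵥ (B k i *ᵥ a i))⁻¹ •
        ketbra (((B k i)ᴴ * B k i) *ᵥ a i)) := by
    intro k
    rw [star_tensorVec_dotProduct, ketbra_tensorVec, ← Finset.prod_inv_distrib, ← tensorOp_smul]
    refine tensorOp_eq_tensorOpSlot P _ i fun j hj => ?_
    -- Away from party i an isometry preserves the norm and pulls the vector back to a j, so the
    -- factor is P j for every k.
    rw [Matrix.star_mulVec, ← Matrix.dotProduct_mulVec, Matrix.mulVec_mulVec, hisom k j hj,
      Matrix.one_mulVec]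
  have h2 : (star (tensorVec a) ⬝ᵥ tensorVec a)⁻¹ • ketbra (tensorVec a) =
      tensorOpSlot P i ((star (a i) ⬝ᵥ a i)⁻¹ • ketbra (a i)) := by
    rw [star_tensorVec_dotProduct, ketbra_tensorVec, ← Finset.prod_inv_distrib, ← tensorOp_smul]
    exact tensorOp_eq_tensorOpSlot P _ i fun j hj => rfl
  rw [h2, Finset.sum_congr rfl fun k _ => h1 k, ← map_sum, ← map_sub, tensorOpSlot_apply]
  refine tensorOp_mem_sepCone _ fun j => ?_
  by_cases hj : j = i
  · subst hj
    rw [Function.update_self]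
    exact posSemidef_sum_ketbra_sub (fun k => B k j) hmeas (a j)
  · rw [Function.update_of_ne hj]
    exact hPpos j

end SepCone

/-! ### Induction on LOCC protocols -/

section LOCC

variable {K : ℕ} {Ω : Type*} [DecidableEq Ω]

lemma IsLOCC.posSemidef {d : Fin K → ℕ} {M : Ω → Matrix (MIdx d) (MIdx d) ℂ} (h : IsLOCC d M)
    (ω : Ω) : (M ω).PosSemidef := by
  induction h with
  | decide d ω' =>
    by_cases hω : ω = ω'
    · simpa [hω] using Matrix.PosSemidef.one
    · simpa [hω] using Matrix.PosSemidef.zero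
  | round d i m d' B hmeas hisom M hM ih =>
    exact Matrix.posSemidef_sum _ fun k _ => (ih k).conjTranspose_mul_mul_same _

lemma sum_conjTranspose_tensorOp_mul_tensorOp {d : Fin K → ℕ} {m : ℕ} {d' : Fin m → Fin K → ℕ}
    (i : Fin K) (B : ∀ k j, Matrix (Fin (d' k j)) (Fin (d j)) ℂ)
    (hmeas : ∑ k, (B k i)ᴴ * B k i = 1)
    (hisom : ∀ k j, j ≠ i → (B k j)ᴴ * B k j = 1) :
    ∑ k, (tensorOp (B k))ᴴ * tensorOp (B k) = 1 := by
  have : ∀ k, (tensorOp (B k))ᴴ * tensorOp (B k) =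
      tensorOpSlot (fun j => 1) i ((B k i)ᴴ * B k i) := by
    intro k
    rw [tensorOp_conjTranspose, tensorOp_mul]
    exact tensorOp_eq_tensorOpSlot _ _ i (hisom k)
  rw [Finset.sum_congr rfl fun k _ => this k, ← map_sum, hmeas, ← tensorOp_one]
  exact (tensorOp_eq_tensorOpSlot _ _ i fun _ _ => rfl).symm

variable [Fintype Ω]

lemma IsLOCC.sum_eq_one {d : Fin K → ℕ} {M : Ω → Matrix (MIdx d) (MIdx d) ℂ} (h : IsLOCC d M) :
    ∑ ω, M ω = 1 := by
  induction h with
  | decide d ω' => simp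
  | round d i m d' B hmeas hisom M hM ih =>
    rw [Finset.sum_comm, ← sum_conjTranspose_tensorOp_mul_tensorOp i B hmeas hisom]
    refine Finset.sum_congr rfl fun k _ => ?_
    rw [← Matrix.sum_mul, ← Matrix.mul_sum, ih k, Matrix.mul_one]

/-- The projector onto the orthogonal complement of product vectors (possibly zero) that are
identified with certainty by an LOCC measurement is separable. -/
theorem IsLOCC.one_sub_sum_ketbra_mem_sepCone {d : Fin K → ℕ}
    {M : Ω → Matrix (MIdx d) (MIdx d) ℂ} (h : IsLOCC d M) (a : Ω → ∀ i, Fin (d i) → ℂ)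
    (ha : ∀ k j, k ≠ j → star (tensorVec (a j)) ⬝ᵥ (M k *ᵥ tensorVec (a j)) = 0) :
    1 - ∑ ω, (star (tensorVec (a ω)) ⬝ᵥ tensorVec (a ω))⁻¹ • ketbra (tensorVec (a ω)) ∈
      sepCone d := by
  induction h with
  | decide d ω =>
    rw [Finset.sum_eq_single ω]
    · exact one_sub_ketbra_tensorVec_mem_sepCone _
    · intro j _ hj
      -- The announced outcome has operator 1, so zero error for j ≠ ω forces the j-th vector to
      -- have norm zero.
      have := ha ω j hj.symm
      simp only [if_true, Matrix.one_mulVec] at this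
      rw [this, inv_zero, zero_smul]
    · simp
  | round d i m d' B hmeas hisom M hM ih =>
    have hcone := fun k => ih k (fun ω j => B k j *ᵥ a ω j) (by
      intro ω j hne
      have h0 := ha ω j hne
      simp only [Matrix.sum_mulVec, dotProduct_sum] at h0
      -- The error is a sum of nonnegative contributions of the branches, so each branch is
      -- error-free on its unnormalized post-measurement vectors.
      rw [Finset.sum_eq_zero_iff_of_nonneg] at h0
      · have := h0 k (Finset.mem_univ k)
        rwa [← Matrix.mulVec_mulVec, ← Matrix.mulVec_mulVec, Matrix.dotProduct_mulVec,
          ← Matrix.star_mulVec, tensorOp_mulVec] at this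
      · intro k _
        exact (((hM k).posSemidef ω).conjTranspose_mul_mul_same _).dotProduct_mulVec_nonneg _)
    have hsum := sum_mem fun k (_ : k ∈ Finset.univ) => conj_tensorOp_mem_sepCone (B k) (hcone k)
    have hloc := sum_mem fun ω (_ : ω ∈ Finset.univ) =>
      sum_ketbra_sub_mem_sepCone i B hmeas hisom (a ω)
    convert add_mem hsum hloc using 1
    have hterm : ∀ k, (tensorOp (B k))ᴴ * (1 - ∑ ω, (star (tensorVec fun j => B k j *ᵥ a ω j) ⬝ᵥ
        tensorVec fun j => B k j *ᵥ a ω j)⁻¹ • ketbra (tensorVec fun j => B k j *ᵥ a ω j)) *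
          tensorOp (B k) = (tensorOp (B k))ᴴ * tensorOp (B k) -
        ∑ ω, (star (tensorVec fun j => B k j *ᵥ a ω j) ⬝ᵥ tensorVec fun j => B k j *ᵥ a ω j)⁻¹ •
          ketbra (tensorVec fun j => ((B k j)ᴴ * B k j) *ᵥ a ω j) := by
      intro k
      rw [Matrix.mul_sub, Matrix.sub_mul, Matrix.mul_one, Matrix.mul_sum, Matrix.sum_mul]
      congr 1
      refine Finset.sum_congr rfl fun ω _ => ?_
      have := mul_ketbra_mul_conjTranspose (tensorOp (B k))ᴴ (tensorVec fun j => B k j *ᵥ a ω j)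
      rw [Matrix.conjTranspose_conjTranspose] at this
      rw [Matrix.mul_smul, Matrix.smul_mul, this, tensorOp_conjTranspose, tensorOp_mulVec]
      simp only [Matrix.mulVec_mulVec]
    rw [Finset.sum_congr rfl fun k _ => hterm k, Finset.sum_sub_distrib, Finset.sum_sub_distrib,
      sum_conjTranspose_tensorOp_mul_tensorOp i B hmeas hisom, Finset.sum_comm]
    abel

/-- Vectors identified with certainty by an LOCC measurement are pairwise orthogonal. -/
lemma IsLOCC.dotProduct_eq_zero {d : Fin K → ℕ} {M : Ω → Matrix (MIdx d) (MIdx d) ℂ}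
    (h : IsLOCC d M) (v : Ω → MIdx d → ℂ)
    (hv : ∀ k j, k ≠ j → star (v j) ⬝ᵥ (M k *ᵥ v j) = 0) {k j : Ω} (hkj : k ≠ j) :
    star (v k) ⬝ᵥ v j = 0 := by
  have h0 : ∀ k j, k ≠ j → M k *ᵥ v j = 0 := fun k j hkj =>
    ((h.posSemidef k).dotProduct_mulVec_zero_iff _).1 (hv k j hkj)
  -- Only M j acts nontrivially on v j, so completeness makes v j a fixed vector of M j, while M j
  -- annihilates v k.
  have h1 : v j = M j *ᵥ v j := by
    conv_lhs => rw [← Matrix.one_mulVec (v j), ← h.sum_eq_one, Matrix.sum_mulVec]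
    exact Finset.sum_eq_single j (fun l _ hl => h0 l j hl) (by simp)
  rw [h1, Matrix.dotProduct_mulVec, ← (h.posSemidef j).isHermitian.eq, ← Matrix.star_mulVec,
    h0 j k hkj.symm, star_zero, zero_dotProduct]

end LOCC

/-! ### The discriminating measurement -/

theorem corollary1 {K : ℕ} (d : Fin K → ℕ) (n : ℕ)
    (φ : Fin n → MIdx d → ℂ) (hprod : ∀ j, IsProductState (φ j))
    (hlocc : LOCCDistinguishable (fun j => ketbra (φ j)))
    (σ : Matrix (MIdx d) (MIdx d) ℂ) (hσ : IsDensity σ)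
    (horth : ∀ j, ∀ v ∈ stateSupport σ, star (φ j) ⬝ᵥ v = 0) :
    SepDistinguishable
      (fun o : Option (Fin n) => o.elim σ (fun j => ketbra (φ j))) := by
  obtain ⟨M, hM, hdisc⟩ := hlocc
  choose a ha using fun j => (hprod j).2
  have hzero : ∀ k j, k ≠ j → star (φ j) ⬝ᵥ (M k *ᵥ φ j) = 0 := by
    intro k j hkj
    rw [← trace_ketbra_mul, Matrix.trace_mul_comm, hdisc k j, if_neg hkj]
  have hortho : ∀ k j, star (φ k) ⬝ᵥ φ j = if k = j then 1 else 0 := by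
    intro k j
    split_ifs with h
    · rw [h, (hprod j).1]
    · exact hM.dotProduct_eq_zero φ hzero h
  set Q : Matrix (MIdx d) (MIdx d) ℂ := 1 - ∑ j, ketbra (φ j) with hQ
  have hQmem : Q ∈ sepCone d := by
    have := hM.one_sub_sum_ketbra_mem_sepCone a (by simpa only [← ha] using hzero)
    simpa only [← ha, (hprod _).1, inv_one, one_smul] using this
  have hφσ : ∀ j, (ketbra (φ j) * σ).trace = 0 := by
    intro j
    rw [trace_ketbra_mul]
    -- The trace is ⟨φ_j, σ φ_j⟩, and σ φ_j lies in the support of σ.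
    exact horth j _ ⟨φ j, rfl⟩
  have hφφ : ∀ k j, (ketbra (φ k) * ketbra (φ j)).trace = if k = j then 1 else 0 := by
    intro k j
    rw [trace_ketbra_mul, dotProduct_ketbra_mulVec, hortho]
    split_ifs <;> simp
  have hQσ : (Q * σ).trace = 1 := by
    rw [hQ, Matrix.sub_mul, Matrix.one_mul, Matrix.trace_sub, Finset.sum_mul, Matrix.trace_sum,
      Finset.sum_eq_zero fun j _ => hφσ j, hσ.2, sub_zero]
  have hQφ : ∀ j, (Q * ketbra (φ j)).trace = 0 := by
    intro j
    rw [hQ, Matrix.sub_mul, Matrix.one_mul, Matrix.trace_sub, Finset.sum_mul, Matrix.trace_sum]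
    have htr : (ketbra (φ j)).trace = 1 := by
      rw [ketbra, Matrix.trace_vecMulVec, dotProduct_comm, (hprod j).1]
    simp [hφφ, htr]
  refine ⟨fun o => o.elim Q fun j => ketbra (φ j), ⟨?_, ?_⟩, ?_⟩
  · rintro (_ | j)
    · refine isSeparableOp_of_mem_sepCone hQmem fun h => ?_
      have h0 : Q = 0 := h
      simp [h0] at hQσ
    · refine isSeparableOp_of_mem_sepCone ?_ fun h => ?_
      · have h1 := ofReal_smul_ketbra_tensorVec_mem zero_le_one (a j)
        rwa [Complex.ofReal_one, one_smul, ← ha j] at h1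
      · have h1 := hφφ j j
        have h2 : ketbra (φ j) = 0 := h
        simp [h2] at h1
  · simp [Fintype.sum_option, hQ]
  · rintro (_ | k) (_ | j)
    · simpa using hQσ
    · simpa using hQφ j
    · simpa using hφσ k
    · simpa using hφφ k j
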